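/- Let $\{a_j\},\{b_j\},\{c_j\}$, $j\ge 1$, be bounded complex sequences with $a_jc_j\neq 0$ for all $j$, and let $J$ be the Jacobi operator on $\ell^2(\mathbb N)$, $$(Jx)_n=a_{n-1}x_{n-1}+b_nx_n+c_nx_{n+1}\quad(n\ge1,\ x_0:=0).$$ Let $J_0$ be the operator with $a_j=c_j=1$, $b_j=0$. Put $a_0=c_0=1$ and $$\delta_n=|b_n|+|1-a_{n-1}c_{n-1}|,\qquad \Delta=\sum_{n\ge1}\delta_n=\sum_{n\ge 1}\bigl(|b_n|+|1-a_nc_n|\bigr),\qquad \Delta_1=\sum_{n\ge1}n\,\delta_n .$$ Let $\lambda(z)=z+1/z$, $\lambda(0)=\infty$. For $\lambda\in\overline{\mathbb C}\setminus[-2,2]$ let $$L(\lambda,J)=\det\bigl(I+(J-J_0)(J_0-\lambda)^{-1}\bigr)$$ be the perturbation determinant, where $(J_0-\infty)^{-1}=0$ and $\det(I+A)=\sum_{S}\det(\langle e_i,Ae_j\rangle)_{i,j\in S}$, summed over the finite sets $S\subset\mathbb N$, is the Fredholm determinant. Assume that $J-J_0$ is of trace class. Then: 1. $\Delta<\infty$,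 and for every $z$ with $|z|<1$ the series defining $L(\lambda(z),J)$ converges absolutely and $$\log|L(\lambda(z),J)|\le\frac{2|z|\,\Delta}{|1-z^2|}.$$ 2. If moreover $\Delta_1<\infty$, then $z\mapsto L(\lambda(z),J)$ extends from the open unit disk to a continuous function on the closed unit disk, and the extension, again denoted by $L(\lambda(z),J)$, satisfies $$\log|L(\lambda(z),J)|\le|z|\,\Delta_1,\qquad |z|\le1 .$$ Here $\log 0=-\infty$. -/

import Mathlib

noncomputable section

/-- The absolute value `|A| = (A* A)^{1/2}` of a bounded operator on a Hilbert space. -/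
def absOp {H : Type*} [NormedAddCommGroup H] [InnerProductSpace ℂ H] [CompleteSpace H]
    (A : H →L[ℂ] H) : H →L[ℂ] H := CFC.abs A

/-- The Hilbert space `ℓ²(ℕ)`. The index `n : ℕ` stands for the `(n+1)`-st coordinate. -/
abbrev HalfLine : Type := lp (fun _ : ℕ => ℂ) 2

namespace HalfLine

/-- The standard orthonormal basis of `ℓ²(ℕ)`. -/
def e (n : ℕ) : HalfLine := lp.single 2 n (1 : ℂ)

/-- The matrix entry `⟨e_i, A e_j⟩`, that is, row `i`, column `j`. -/
def entry (A : HalfLine →L[ℂ] HalfLine) (i j : ℕ) : ℂ := inner ℂ (e i) (A (e j))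

/-- `A` is of trace class: `Tr |A| = ∑ ⟨e_n, |A| e_n⟩ < ∞`. -/
def IsTraceClass (A : HalfLine →L[ℂ] HalfLine) : Prop :=
  Summable fun n : ℕ => entry (absOp A) n n

/-- The principal minor of `A` on a finite set `S` of indices, `⟨e_S, Λ^{|S|}(A) e_S⟩`
with `e_S` the wedge product of the `e_i`, `i ∈ S`. It is `1` when `S` is empty. -/
def principalMinor (A : HalfLine →L[ℂ] HalfLine) (S : Finset ℕ) : ℂ :=
  Matrix.det (Matrix.of fun i j : S => entry A i j)

/-- The Fredholm determinant `det (I + A) = ∑_k Tr Λ^k(A)`, each trace being computed in the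
standard orthonormal basis of the `k`-th exterior power. -/
def fredholmDet (A : HalfLine →L[ℂ] HalfLine) : ℂ :=
  ∑' S : Finset ℕ, principalMinor A S

end HalfLine

/-- The entries of a semi-infinite Jacobi matrix
`[[b₀, c₀, 0, …], [a₀, b₁, c₁, 0, …], [0, a₁, b₂, c₂, …], …]` (indices shifted to start at `0`):
uniformly bounded complex sequences with nonvanishing products `a_j c_j`. -/
structure JacobiMatrix where
  a : ℕ → ℂ
  b : ℕ → ℂ
  c : ℕ → ℂ
  bounded : ∃ M : ℝ, ∀ n, ‖a n‖ ≤ M ∧ ‖b n‖ ≤ M ∧ ‖c n‖ ≤ M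
  mul_ne_zero : ∀ n, a n * c n ≠ 0

namespace JacobiMatrix

/-- The sequence `0, a₀ x₀, a₁ x₁, …`, i.e. the action of the subdiagonal. -/
def lower (J : JacobiMatrix) (x : ℕ → ℂ) : ℕ → ℂ
  | 0 => 0
  | n + 1 => J.a n * x n

/-- The formal action of the matrix: `(J x)_n = a_{n-1} x_{n-1} + b_n x_n + c_n x_{n+1}`. -/
def act (J : JacobiMatrix) (x : ℕ → ℂ) (n : ℕ) : ℂ :=
  J.lower x n + J.b n * x n + J.c n * x (n + 1)

theorem act_bound (J : JacobiMatrix) {M : ℝ}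
    (hM : ∀ n, ‖J.a n‖ ≤ M ∧ ‖J.b n‖ ≤ M ∧ ‖J.c n‖ ≤ M) (x : HalfLine) :
    Summable (fun n => ‖J.act x n‖ ^ 2) ∧
      ∑' n, ‖J.act x n‖ ^ 2 ≤ (3 * M * ‖x‖) ^ 2 := by
  have hM0 : 0 ≤ M := (norm_nonneg _).trans (hM 0).1
  have hs : Summable (fun n => ‖x n‖ ^ 2) := by
    have := (lp.memℓp x).summable (p := 2) (by norm_num)
    simpa using this
  have hn : ‖x‖ ^ 2 = ∑' n, ‖x n‖ ^ 2 := by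
    have := lp.norm_rpow_eq_tsum (p := 2) (by norm_num) x
    simpa using this
  have key : ∀ (f : ℕ → ℂ) (k y : ℕ → ℂ), (∀ n, ‖k n‖ ≤ M) → (∀ n, f n = k n * y n) →
      Summable (fun n => ‖y n‖ ^ 2) → ∑' n, ‖y n‖ ^ 2 ≤ ‖x‖ ^ 2 →
      Summable (fun n => ‖f n‖ ^ 2) ∧ ∑' n, ‖f n‖ ^ 2 ≤ M ^ 2 * ‖x‖ ^ 2 := by
    intro f k y hk hf hy hyx
    have hle : ∀ n, ‖f n‖ ^ 2 ≤ M ^ 2 * ‖y n‖ ^ 2 := by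
      intro n
      rw [hf, norm_mul, mul_pow]
      have := hk n
      gcongr
    have h1 : Summable (fun n => ‖f n‖ ^ 2) :=
      Summable.of_nonneg_of_le (fun n => by positivity) hle (hy.mul_left _)
    refine ⟨h1, (h1.tsum_le_tsum hle (hy.mul_left _)).trans ?_⟩
    rw [tsum_mul_left]
    gcongr
  have hs1 : Summable (fun n => ‖x (n + 1)‖ ^ 2) :=
    (summable_nat_add_iff (f := fun n => ‖x n‖ ^ 2) 1).2 hs
  have hx1 : ∑' n, ‖x (n + 1)‖ ^ 2 ≤ ‖x‖ ^ 2 := by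
    rw [hn, hs.tsum_eq_zero_add]
    have : (0 : ℝ) ≤ ‖x 0‖ ^ 2 := by positivity
    linarith
  obtain ⟨hb, hb'⟩ := key (fun n => J.b n * x n) J.b x (fun n => (hM n).2.1) (fun _ => rfl) hs hn.ge
  obtain ⟨hc, hc'⟩ := key (fun n => J.c n * x (n + 1)) J.c (fun n => x (n + 1))
    (fun n => (hM n).2.2) (fun _ => rfl) hs1 hx1
  obtain ⟨ha, ha'⟩ := key (fun n => J.a n * x n) J.a x (fun n => (hM n).1) (fun _ => rfl) hs hn.ge
  have hl : Summable (fun n => ‖J.lower x n‖ ^ 2) :=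
    (summable_nat_add_iff (f := fun n => ‖J.lower x n‖ ^ 2) 1).1 ha
  have hl' : ∑' n, ‖J.lower x n‖ ^ 2 ≤ M ^ 2 * ‖x‖ ^ 2 := by
    rw [hl.tsum_eq_zero_add]
    simpa [lower] using ha'
  have hle : ∀ n, ‖J.act x n‖ ^ 2 ≤
      3 * (‖J.lower x n‖ ^ 2 + ‖J.b n * x n‖ ^ 2 + ‖J.c n * x (n + 1)‖ ^ 2) := by
    intro n
    have h := norm_add₃_le (a := J.lower x n) (b := J.b n * x n) (c := J.c n * x (n + 1))
    have h0 : 0 ≤ ‖J.act x n‖ := norm_nonneg _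
    calc ‖J.act x n‖ ^ 2
        ≤ (‖J.lower x n‖ + ‖J.b n * x n‖ + ‖J.c n * x (n + 1)‖) ^ 2 := by
          unfold act; gcongr
      _ ≤ _ := by
          nlinarith [sq_nonneg (‖J.lower x n‖ - ‖J.b n * x n‖),
            sq_nonneg (‖J.lower x n‖ - ‖J.c n * x (n + 1)‖),
            sq_nonneg (‖J.b n * x n‖ - ‖J.c n * x (n + 1)‖)]
  have hsum := ((hl.add hb).add hc).mul_left 3
  have h1 : Summable (fun n => ‖J.act x n‖ ^ 2) :=
    Summable.of_nonneg_of_le (fun n => by positivity) hle hsum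
  refine ⟨h1, (h1.tsum_le_tsum hle hsum).trans ?_⟩
  rw [tsum_mul_left, (hl.add hb).tsum_add hc, hl.tsum_add hb]
  nlinarith

theorem act_memℓp (J : JacobiMatrix) (x : HalfLine) : Memℓp (J.act x) 2 := by
  obtain ⟨M, hM⟩ := J.bounded
  apply memℓp_gen
  simpa using (J.act_bound hM x).1

/-- The action of the Jacobi matrix on `ℓ²(ℕ)` as a linear map. -/
def toLinearMap (J : JacobiMatrix) : HalfLine →ₗ[ℂ] HalfLine where
  toFun x := ⟨J.act x, J.act_memℓp x⟩
  map_add' x y := by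
    apply lp.ext
    funext n
    change J.act (fun k => x k + y k) n = J.act x n + J.act y n
    rcases n with _ | n <;> simp only [act, lower] <;> ring
  map_smul' r x := by
    apply lp.ext
    funext n
    change J.act (fun k => r * x k) n = r * J.act x n
    rcases n with _ | n <;> simp only [act, lower] <;> ring

/-- The bounded Jacobi operator on `ℓ²(ℕ)`. -/
def op (J : JacobiMatrix) : HalfLine →L[ℂ] HalfLine :=
  J.toLinearMap.mkContinuousOfExistsBound <| by
    obtain ⟨M, hM⟩ := J.bounded
    have hM0 : 0 ≤ M := (norm_nonneg _).trans (hM 0).1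
    refine ⟨3 * M, fun x => lp.norm_le_of_tsum_le (p := 2) (by norm_num) (by positivity) ?_⟩
    have h := (J.act_bound hM x).2
    have h2 : ∀ n, J.toLinearMap x n = J.act x n := fun _ => rfl
    simpa [h2] using h

@[simp] theorem op_apply (J : JacobiMatrix) (x : HalfLine) (n : ℕ) :
    J.op x n = J.act x n := rfl

/-- The discrete Laplacian `J₀ = J({1},{0},{1})`. -/
def free : JacobiMatrix where
  a _ := 1
  b _ := 0
  c _ := 1
  bounded := ⟨1, by simp⟩
  mul_ne_zero := by simp

/-- `δ_{n+1} = |b_{n+1}| + |1 - a_n c_n|` in indices starting at `1`, with `a_0 = c_0 = 1`. -/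
def delta (J : JacobiMatrix) : ℕ → ℝ
  | 0 => ‖J.b 0‖
  | n + 1 => ‖J.b (n + 1)‖ + ‖1 - J.a n * J.c n‖

/-- `Δ = ∑_{n ≥ 1} δ_n`, which equals `∑_{n ≥ 1} (|b_n| + |1 - a_n c_n|)`. -/
def Delta (J : JacobiMatrix) : ℝ := ∑' n : ℕ, J.delta n

/-- `Δ₁ = ∑_{n ≥ 1} n δ_n`. -/
def Delta₁ (J : JacobiMatrix) : ℝ := ∑' n : ℕ, ((n : ℝ) + 1) * J.delta n

/-- The resolvent `(J₀ - μ)⁻¹` on the Riemann sphere, equal to `0` at `μ = ∞`. -/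
def freeResolvent : OnePoint ℂ → (HalfLine →L[ℂ] HalfLine)
  | none => 0
  | some μ => Ring.inverse (free.op - μ • ContinuousLinearMap.id ℂ HalfLine)

/-- The perturbation determinant `L(μ, J) = det (I + (J - J₀)(J₀ - μ)⁻¹)`. -/
def perturbationDet (μ : OnePoint ℂ) (J : JacobiMatrix) : ℂ :=
  HalfLine.fredholmDet ((J.op - free.op) * freeResolvent μ)

end JacobiMatrix

open Classical in
/-- The Zhukovsky function `λ(z) = z + 1/z` with `λ(0) = ∞`. -/
def zhukovsky (z : ℂ) : OnePoint ℂ :=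
  if z = 0 then OnePoint.infty else ((z + 1 / z : ℂ) : OnePoint ℂ)

end

/-! Let D_n be the leading minors of 1 + z² - zJ. They obey a three-term recurrence in which only
b_n and the products a_n c_n appear. When J = J₀ its characteristic roots are 1 and z². Factoring
out the root z², D_{n+1} - z² D_n = 1 + ∑_{k≤n} f_k, where f_k is linear in D_k and D_{k-1} with
coefficients of total size at most |z| δ. If |D_n| ≤ w_n M_n, where M_n = 1 + ∑_{k<n} |f_k| and w is
monotone, then M_{n+1} ≤ M_n (1 + |z| w_n δ_n), a discrete Gronwall inequality giving M_n ≤ exp(|z|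
∑ w_k δ_k). Solving the recurrence for D_n permits w = 2/|1 - z²| inside the disk and w_n = n + 1 on
the closed disk; these weights give the two stated bounds.

The Jost series 1 + ∑ f_k is then identified with the determinant. The free resolvent has matrix -zG
with G = L Lᵀ and L unipotent lower triangular, so the sections of I + (J - J₀)(J₀ - λ)⁻¹ have
determinant D_{n+1} - z² c_n D_n (`det_one_add_leading_pertKernel`). Since c_n → 1 and D_n stays
bounded inside the disk, these have the same limit as the partial sums of the Jost series.

The trace class hypothesis enters through absolute summability of the three diagonals of J - J₀
(`IsTraceClass.summable_norm_entry`). This gives Δ < ∞, c_n → 1, and summable row norms of the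
perturbation, hence absolute convergence of the sum of minors. -/

open Filter Topology

/-! ### Finite sections, principal minors and tridiagonal determinants -/

namespace Matrix

/-- The leading `n × n` section of an infinite matrix. -/
def leading (t : ℕ → ℕ → ℂ) (n : ℕ) : Matrix (Fin n) (Fin n) ℂ :=
  Matrix.of fun i j => t i j

/-- Multilinearity in the rows: each row of 1 + T is taken from T or from 1, and unit rows outside a
set leave the principal minor on that set. This is how partial sums of the Fredholm series become
finite determinants. -/
theorem sum_powerset_range_det (t : ℕ → ℕ → ℂ) (n : ℕ) :
    ∑ S ∈ (Finset.range n).powerset, det (Matrix.of fun i j : S => t i j) =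
      det (1 + leading t n) := by
  have h1 : det (1 + leading t n) =
      ∑ s : Finset (Fin n), det ((leading t n).submatrix (fun x : s => (x : Fin n)) (fun x => x)) := by
    have h := (detRowAlternating (n := Fin n) (R := ℂ)).toMultilinearMap.map_add_univ
      (leading t n).row (1 : Matrix (Fin n) (Fin n) ℂ).row
    rw [add_comm]
    refine Eq.trans ?_ (h.trans (Finset.sum_congr rfl fun s _ => ?_))
    · rfl
    · exact det_piecewise_one_eq_submatrix_det _ s
  rw [h1]
  symm
  refine Finset.sum_bij' (fun s _ => s.map Fin.valEmbedding)
    (fun S _ => Finset.univ.filter fun i : Fin n => (i : ℕ) ∈ S) ?_ ?_ ?_ ?_ ?_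
  · intro s _
    simp only [Finset.mem_powerset]
    intro x hx
    obtain ⟨y, -, rfl⟩ := Finset.mem_map.1 hx
    simp
  · simp
  · intro s _
    ext i
    simp only [Finset.mem_filter, Finset.mem_univ, true_and, Finset.mem_map,
      Fin.valEmbedding_apply]
    exact ⟨fun ⟨a, ha, h⟩ => Fin.ext h ▸ ha, fun h => ⟨i, h, rfl⟩⟩
  · intro S hS
    ext i
    simp only [Finset.mem_map, Finset.mem_filter, Finset.mem_univ, true_and, Fin.valEmbedding_apply]
    constructor
    · rintro ⟨a, ha, rfl⟩
      exact ha
    · intro hi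
      exact ⟨⟨i, by simpa using Finset.mem_powerset.1 hS hi⟩, hi, rfl⟩
  · intro s _
    let φ : s ≃ (s.map Fin.valEmbedding : Finset ℕ) :=
      Equiv.ofBijective (fun x => ⟨(x : Fin n), Finset.mem_map_of_mem _ x.2⟩)
        ⟨fun x y h => Subtype.ext (Fin.ext (Subtype.ext_iff.1 h)), fun ⟨y, hy⟩ => by
          obtain ⟨x, hx, rfl⟩ := Finset.mem_map.1 hy
          exact ⟨⟨x, hx⟩, rfl⟩⟩
    rw [← det_submatrix_equiv_self φ]
    rfl

theorem det_leading_congr {s t : ℕ → ℕ → ℂ} {n : ℕ} (h : ∀ i < n, ∀ j < n, s i j = t i j) :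
    det (leading s n) = det (leading t n) := by
  congr 1
  ext i j
  exact h i i.2 j j.2

/-- The three-term recurrence for the leading minors of a tridiagonal matrix. -/
theorem det_leading_tridiagonal (t : ℕ → ℕ → ℂ) (ht : ∀ i j, i + 1 < j ∨ j + 1 < i → t i j = 0)
    (n : ℕ) :
    det (leading t (n + 2)) = t (n + 1) (n + 1) * det (leading t (n + 1)) -
      t (n + 1) n * t n (n + 1) * det (leading t n) := by
  have hsub : ((leading t (n + 2)).submatrix (Fin.last (n + 1)).succAbove
      (Fin.last (n + 1)).succAbove) = leading t (n + 1) := by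
    ext i j
    simp [leading, Fin.succAbove_last]
  have hminor : det ((leading t (n + 2)).submatrix (Fin.last (n + 1)).succAbove
      (Fin.castSucc (Fin.last n)).succAbove) = t n (n + 1) * det (leading t n) := by
    rw [det_succ_column _ (Fin.last n), Fin.sum_univ_castSucc]
    have hz : ∀ i : Fin n, (leading t (n + 2)).submatrix (Fin.last (n + 1)).succAbove
        (Fin.castSucc (Fin.last n)).succAbove i.castSucc (Fin.last n) = 0 := by
      intro i
      simp only [leading, submatrix_apply, of_apply, Fin.succAbove_last]
      apply ht
      left
      simp
    have hs : (((leading t (n + 2)).submatrix (Fin.last (n + 1)).succAbove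
        (Fin.castSucc (Fin.last n)).succAbove).submatrix (Fin.last n).succAbove
        (Fin.last n).succAbove) = leading t n := by
      ext i j
      simp only [leading, submatrix_apply, of_apply, Fin.succAbove_last]
      congr 1
      rw [Fin.succAbove_of_castSucc_lt]
      · simp
      · simp [Fin.lt_def]
    have hl : (leading t (n + 2)).submatrix (Fin.last (n + 1)).succAbove
        (Fin.castSucc (Fin.last n)).succAbove (Fin.last n) (Fin.last n) = t n (n + 1) := by
      simp [leading, Fin.succAbove_last]
    rw [hs, hl]
    simp only [hz]
    simp [← two_mul, pow_mul]
  rw [det_succ_row _ (Fin.last (n + 1)), Fin.sum_univ_castSucc, Fin.sum_univ_castSucc, hsub, hminor]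
  have hz : ∀ i : Fin n, leading t (n + 2) (Fin.last (n + 1)) i.castSucc.castSucc = 0 := by
    intro i
    simp only [leading, of_apply]
    apply ht
    right
    simp
  simp only [hz]
  simp [leading, ← two_mul, pow_mul]
  ring

/-- A determinant is bounded by the product of the `ℓ¹`-norms of the rows. -/
theorem norm_det_le_prod_sum {m : Type*} [Fintype m] [DecidableEq m] (M : Matrix m m ℂ) :
    ‖det M‖ ≤ ∏ i, ∑ j, ‖M i j‖ := by
  rw [← det_transpose, det_apply, Finset.prod_univ_sum, Fintype.piFinset_univ]
  refine (norm_sum_le _ _).trans ?_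
  have h : ∀ σ : Equiv.Perm m, ‖Equiv.Perm.sign σ • ∏ i, Mᵀ (σ i) i‖ = ∏ i, ‖M i (σ i)‖ := by
    intro σ
    rcases Int.units_eq_one_or (Equiv.Perm.sign σ) with h | h <;> simp [h]
  simp only [h]
  -- The product of the row sums expands over all maps m → m. Permutations are some of these, and
  -- the remaining terms are nonnegative.
  have hi : Function.Injective (fun σ : Equiv.Perm m => (σ : m → m)) := DFunLike.coe_injective
  rw [← Finset.sum_image (f := fun p : m → m => ∏ i, ‖M i (p i)‖) (s := Finset.univ)
    (g := fun σ : Equiv.Perm m => (σ : m → m)) (fun a _ b _ hab => hi hab)]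
  exact Finset.sum_le_sum_of_subset_of_nonneg (Finset.subset_univ _)
    fun p _ _ => Finset.prod_nonneg fun i _ => norm_nonneg _

end Matrix

/-- Minors of a matrix with summable rows are summable. -/
theorem summable_det_of_row_bound (t : ℕ → ℕ → ℂ) (w : ℕ → ℝ) (hw : Summable w)
    (h : ∀ i (S : Finset ℕ), ∑ j ∈ S, ‖t i j‖ ≤ w i) :
    Summable fun S : Finset ℕ => Matrix.det (Matrix.of fun i j : S => t i j) := by
  have hw0 : ∀ i, 0 ≤ w i := fun i => by simpa using h i ∅
  have hs : Summable fun S : Finset ℕ => ∏ i ∈ S, w i := summable_finsetProd_of_summable_nonneg hw0 hw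
  refine Summable.of_norm_bounded hs fun S => ?_
  refine (Matrix.norm_det_le_prod_sum _).trans ?_
  rw [← Finset.prod_coe_sort S]
  refine Finset.prod_le_prod (fun i _ => Finset.sum_nonneg fun j _ => norm_nonneg _) fun i _ => ?_
  have := h i S
  rw [← Finset.sum_coe_sort S] at this
  exact this

/-! ### The truncated determinants and the Gronwall bound for the Jost series -/

namespace JacobiMatrix

/-- The leading minors of `1 + z² - z J`. -/
def truncDet (J : JacobiMatrix) (z : ℂ) : ℕ → ℂ
  | 0 => 1
  | 1 => 1 + z ^ 2 - z * J.b 0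
  | n + 2 => (1 + z ^ 2 - z * J.b (n + 1)) * truncDet J z (n + 1) -
      z ^ 2 * (J.a n * J.c n) * truncDet J z n

/-- The increments of `truncDet (n + 1) - z² truncDet n`. -/
def jostTerm (J : JacobiMatrix) (z : ℂ) : ℕ → ℂ
  | 0 => -z * J.b 0
  | n + 1 => -z * J.b (n + 1) * J.truncDet z (n + 1) +
      z ^ 2 * (1 - J.a n * J.c n) * J.truncDet z n

/-- The partial sums `1 + ∑_{k<n} |f_k|` of the increments. -/
noncomputable def jostMajorant (J : JacobiMatrix) (z : ℂ) (n : ℕ) : ℝ :=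
  1 + ∑ k ∈ Finset.range n, ‖J.jostTerm z k‖

theorem delta_nonneg (J : JacobiMatrix) (n : ℕ) : 0 ≤ J.delta n := by
  cases n <;> simp only [delta] <;> positivity

theorem truncDet_succ_sub (J : JacobiMatrix) (z : ℂ) (n : ℕ) :
    J.truncDet z (n + 1) - z ^ 2 * J.truncDet z n =
      1 + ∑ k ∈ Finset.range (n + 1), J.jostTerm z k := by
  induction n with
  | zero => simp [truncDet, jostTerm]; ring
  | succ n ih =>
    rw [Finset.sum_range_succ, ← add_assoc, ← ih, jostTerm, truncDet]
    ring

/-- Variation of constants: the first sum removes the root z² of the free recurrence, and the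
bracket is D_n - D_{n-1} (with D_{-1} = 0), which removes the root 1. Eliminating D_{n-1} leaves the
factor 1 - z². -/
theorem one_sub_sq_mul_truncDet (J : JacobiMatrix) (z : ℂ) (n : ℕ) :
    (1 - z ^ 2) * J.truncDet z n = 1 + ∑ k ∈ Finset.range n, J.jostTerm z k -
      z ^ 2 * (z ^ (2 * n) + ∑ k ∈ Finset.range n, z ^ (2 * (n - 1 - k)) * J.jostTerm z k) := by
  induction n with
  | zero => simp [truncDet]
  | succ n ih =>
    have h1 := J.truncDet_succ_sub z n
    have h2 : ∑ k ∈ Finset.range n, z ^ (2 * (n - k)) * J.jostTerm z k =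
        z ^ 2 * ∑ k ∈ Finset.range n, z ^ (2 * (n - 1 - k)) * J.jostTerm z k := by
      rw [Finset.mul_sum]
      refine Finset.sum_congr rfl fun k hk => ?_
      have := Finset.mem_range.1 hk
      rw [show 2 * (n - k) = 2 + 2 * (n - 1 - k) by omega, pow_add]
      ring
    rw [Finset.sum_range_succ] at h1
    rw [Finset.sum_range_succ, Finset.sum_range_succ]
    simp only [Nat.add_sub_cancel, Nat.sub_self, mul_zero, pow_zero, one_mul]
    rw [h2, show 2 * (n + 1) = 2 + 2 * n by ring, pow_add]
    linear_combination (1 - z ^ 2) * h1 + z ^ 2 * ih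

theorem jostMajorant_nonneg (J : JacobiMatrix) (z : ℂ) (n : ℕ) : 0 ≤ J.jostMajorant z n := by
  unfold jostMajorant; positivity

theorem jostMajorant_mono (J : JacobiMatrix) (z : ℂ) : Monotone (J.jostMajorant z) := by
  refine monotone_nat_of_le_succ fun n => ?_
  simp [jostMajorant, Finset.sum_range_succ]

theorem norm_one_add_sum_le (J : JacobiMatrix) (z : ℂ) (n : ℕ) :
    ‖1 + ∑ k ∈ Finset.range n, J.jostTerm z k‖ ≤ J.jostMajorant z n := by
  refine (norm_add_le _ _).trans ?_
  rw [norm_one]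
  exact add_le_add le_rfl (norm_sum_le _ _)

/-- Iterating D_{n+1} = (partial Jost sum) + z² D_n adds at most one majorant per step. No division
by 1 - z² occurs, so z = ±1 is allowed. -/
theorem norm_truncDet_le_linear (J : JacobiMatrix) {z : ℂ} (hz : ‖z‖ ≤ 1) (n : ℕ) :
    ‖J.truncDet z n‖ ≤ ((n : ℝ) + 1) * J.jostMajorant z n := by
  induction n with
  | zero => simp [truncDet, jostMajorant]
  | succ n ih =>
    have h1 := J.truncDet_succ_sub z n
    have h2 := J.norm_one_add_sum_le z (n + 1)
    have h3 := J.jostMajorant_mono z n.le_succ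
    have h4 : ‖z ^ 2 * J.truncDet z n‖ ≤ ‖J.truncDet z n‖ := by
      rw [norm_mul, norm_pow]
      exact mul_le_of_le_one_left (norm_nonneg _) (pow_le_one₀ (norm_nonneg _) hz)
    rw [← h1] at h2
    have h5 : J.truncDet z (n + 1) =
        (J.truncDet z (n + 1) - z ^ 2 * J.truncDet z n) + z ^ 2 * J.truncDet z n := by ring
    calc ‖J.truncDet z (n + 1)‖ ≤ J.jostMajorant z (n + 1) + ((n : ℝ) + 1) * J.jostMajorant z n := by
          rw [h5]
          exact (norm_add_le _ _).trans (add_le_add h2 (h4.trans ih))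
      _ ≤ J.jostMajorant z (n + 1) + ((n : ℝ) + 1) * J.jostMajorant z (n + 1) := by gcongr
      _ = _ := by push_cast; ring

theorem norm_truncDet_le_div (J : JacobiMatrix) {z : ℂ} (hz : ‖z‖ < 1) (n : ℕ) :
    ‖J.truncDet z n‖ ≤ 2 / ‖1 - z ^ 2‖ * J.jostMajorant z n := by
  have hz2 : ‖z ^ 2‖ ≤ 1 := by rw [norm_pow]; exact pow_le_one₀ (norm_nonneg _) hz.le
  have hne : 0 < ‖1 - z ^ 2‖ := by
    rw [norm_pos_iff, sub_ne_zero]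
    intro h
    have : ‖z ^ 2‖ < 1 := by rw [norm_pow]; exact pow_lt_one₀ (norm_nonneg _) hz two_ne_zero
    rw [← h, norm_one] at this
    exact this.false
  rw [div_mul_eq_mul_div, le_div_iff₀ hne, mul_comm, ← norm_mul, one_sub_sq_mul_truncDet]
  have h1 : ‖z ^ 2 * (z ^ (2 * n) +
      ∑ k ∈ Finset.range n, z ^ (2 * (n - 1 - k)) * J.jostTerm z k)‖ ≤ J.jostMajorant z n := by
    rw [norm_mul]
    refine (mul_le_of_le_one_left (norm_nonneg _) hz2).trans ((norm_add_le _ _).trans ?_)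
    have hp : ∀ m, ‖z ^ m‖ ≤ 1 := fun m => by
      rw [norm_pow]; exact pow_le_one₀ (norm_nonneg _) hz.le
    refine add_le_add (hp _) ((norm_sum_le _ _).trans (Finset.sum_le_sum fun k _ => ?_))
    rw [norm_mul]
    exact mul_le_of_le_one_left (norm_nonneg _) (hp _)
  calc _ ≤ J.jostMajorant z n + J.jostMajorant z n :=
        (norm_sub_le _ _).trans (add_le_add (J.norm_one_add_sum_le z n) h1)
    _ = _ := by ring

section Majorant

variable (J : JacobiMatrix) {z : ℂ} (hz : ‖z‖ ≤ 1) {w : ℕ → ℝ} (hw : Monotone w)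
  (h : ∀ n, ‖J.truncDet z n‖ ≤ w n * J.jostMajorant z n)

include hz hw h

/-- The weight `w` is left general so that one argument serves both bounds. Monotonicity lets D_n
and D_{n-1} share the weight at n. -/
theorem norm_jostTerm_le (n : ℕ) :
    ‖J.jostTerm z n‖ ≤ ‖z‖ * (w n * J.delta n) * J.jostMajorant z n := by
  have hw0 : ∀ n, 0 ≤ w n := fun n => by
    have h0 : 0 ≤ w n * J.jostMajorant z n := (norm_nonneg _).trans (h n)
    have h1 : 0 < J.jostMajorant z n := by unfold jostMajorant; positivity
    exact nonneg_of_mul_nonneg_left h0 h1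
  cases n with
  | zero =>
    have h0 : 1 ≤ w 0 := by simpa [truncDet, jostMajorant] using h 0
    simp only [jostTerm, delta, jostMajorant, Finset.range_zero, Finset.sum_empty, add_zero, mul_one,
      norm_mul, norm_neg]
    gcongr
    exact le_mul_of_one_le_left (norm_nonneg _) h0
  | succ n =>
    have h1 := h (n + 1)
    have h2 : ‖J.truncDet z n‖ ≤ w (n + 1) * J.jostMajorant z (n + 1) :=
      (h n).trans (mul_le_mul (hw n.le_succ) (J.jostMajorant_mono z n.le_succ)
        (J.jostMajorant_nonneg z n) (hw0 _))
    -- The off-diagonal term carries z²; one factor is dropped so that both terms have the common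
    -- factor ‖z‖.
    have hz2 : ‖z‖ ^ 2 ≤ ‖z‖ := by nlinarith [norm_nonneg z]
    calc ‖J.jostTerm z (n + 1)‖
        ≤ ‖z‖ * ‖J.b (n + 1)‖ * ‖J.truncDet z (n + 1)‖ +
          ‖z‖ ^ 2 * ‖1 - J.a n * J.c n‖ * ‖J.truncDet z n‖ := by
          refine (norm_add_le _ _).trans (le_of_eq ?_)
          simp
      _ ≤ ‖z‖ * ‖J.b (n + 1)‖ * (w (n + 1) * J.jostMajorant z (n + 1)) +
          ‖z‖ * ‖1 - J.a n * J.c n‖ * (w (n + 1) * J.jostMajorant z (n + 1)) := by gcongr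
      _ = _ := by simp only [delta]; ring

theorem jostMajorant_le_exp (n : ℕ) :
    J.jostMajorant z n ≤ Real.exp (‖z‖ * ∑ k ∈ Finset.range n, w k * J.delta k) := by
  induction n with
  | zero => simp [jostMajorant]
  | succ n ih =>
    have h1 := J.norm_jostTerm_le hz hw h n
    have h2 : J.jostMajorant z (n + 1) = J.jostMajorant z n + ‖J.jostTerm z n‖ := by
      simp [jostMajorant, Finset.sum_range_succ, add_assoc]
    rw [Finset.sum_range_succ, mul_add, Real.exp_add, h2]
    calc _ ≤ J.jostMajorant z n * (‖z‖ * (w n * J.delta n) + 1) := by linarith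
      _ ≤ J.jostMajorant z n * Real.exp (‖z‖ * (w n * J.delta n)) :=
          mul_le_mul_of_nonneg_left (Real.add_one_le_exp _) (J.jostMajorant_nonneg z n)
      _ ≤ _ := mul_le_mul_of_nonneg_right ih (Real.exp_pos _).le

end Majorant

theorem continuous_truncDet (J : JacobiMatrix) (n : ℕ) : Continuous fun z => J.truncDet z n := by
  induction n using Nat.twoStepInduction with
  | zero => simp only [truncDet]; fun_prop
  | one => simp only [truncDet]; fun_prop
  | more n h0 h1 => simp only [truncDet]; fun_prop

theorem continuous_jostTerm (J : JacobiMatrix) (n : ℕ) : Continuous fun z => J.jostTerm z n := by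
  cases n with
  | zero => simp only [jostTerm]; fun_prop
  | succ n =>
    have h0 := J.continuous_truncDet n
    have h1 := J.continuous_truncDet (n + 1)
    simp only [jostTerm]
    fun_prop

/-- The bound `2 / |1 - z²|` inside the disk. -/
theorem jostMajorant_le_inside (J : JacobiMatrix) (hs : Summable J.delta) {z : ℂ} (hz : ‖z‖ < 1)
    (n : ℕ) : J.jostMajorant z n ≤ Real.exp (2 * ‖z‖ * J.Delta / ‖1 - z ^ 2‖) := by
  refine (J.jostMajorant_le_exp hz.le (w := fun _ => 2 / ‖1 - z ^ 2‖) monotone_const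
    (J.norm_truncDet_le_div hz) n).trans (Real.exp_le_exp.2 ?_)
  rw [← Finset.mul_sum]
  have := hs.sum_le_tsum (Finset.range n) fun k _ => J.delta_nonneg k
  calc _ ≤ ‖z‖ * (2 / ‖1 - z ^ 2‖ * J.Delta) := by unfold Delta; gcongr
    _ = _ := by ring

/-- The bound by the first moment, valid up to the boundary of the disk. -/
theorem jostMajorant_le_closed (J : JacobiMatrix)
    (hs : Summable fun n : ℕ => ((n : ℝ) + 1) * J.delta n) {z : ℂ} (hz : ‖z‖ ≤ 1)
    (n : ℕ) : J.jostMajorant z n ≤ Real.exp (‖z‖ * J.Delta₁) := by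
  have hw : Monotone fun n : ℕ => (n : ℝ) + 1 := fun a b hab => by simpa using hab
  refine (J.jostMajorant_le_exp hz hw (J.norm_truncDet_le_linear hz) n).trans
    (Real.exp_le_exp.2 ?_)
  have := hs.sum_le_tsum (Finset.range n) fun k _ => mul_nonneg (by positivity) (J.delta_nonneg k)
  unfold Delta₁
  gcongr

/-- The Jost function `1 + ∑ f_k`. -/
noncomputable def jost (J : JacobiMatrix) (z : ℂ) : ℂ := 1 + ∑' n, J.jostTerm z n

theorem norm_jostTerm_le_closed (J : JacobiMatrix)
    (hs : Summable fun n : ℕ => ((n : ℝ) + 1) * J.delta n) {z : ℂ} (hz : ‖z‖ ≤ 1) (n : ℕ) :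
    ‖J.jostTerm z n‖ ≤ ((n : ℝ) + 1) * J.delta n * Real.exp J.Delta₁ := by
  have hw : Monotone fun n : ℕ => (n : ℝ) + 1 := fun a b hab => by simpa using hab
  have hd : 0 ≤ J.Delta₁ := tsum_nonneg fun k => mul_nonneg (by positivity) (J.delta_nonneg k)
  have hd' := J.delta_nonneg n
  refine (J.norm_jostTerm_le hz hw (J.norm_truncDet_le_linear hz) n).trans ?_
  refine mul_le_mul ?_ ((J.jostMajorant_le_closed hs hz n).trans
    (Real.exp_le_exp.2 (mul_le_of_le_one_left hd hz))) (J.jostMajorant_nonneg z n) (by positivity)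
  exact mul_le_of_le_one_left (by positivity) hz

theorem continuousOn_jost (J : JacobiMatrix)
    (hs : Summable fun n : ℕ => ((n : ℝ) + 1) * J.delta n) :
    ContinuousOn J.jost (Metric.closedBall 0 1) := by
  refine continuousOn_const.add (continuousOn_tsum (fun n => (J.continuous_jostTerm n).continuousOn)
    (hs.mul_right (Real.exp J.Delta₁)) fun n z hz => ?_)
  exact J.norm_jostTerm_le_closed hs (by simpa using hz) n

theorem tendsto_jost (J : JacobiMatrix)
    (hs : Summable fun n : ℕ => ((n : ℝ) + 1) * J.delta n) {z : ℂ} (hz : ‖z‖ ≤ 1) :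
    Tendsto (fun n => 1 + ∑ k ∈ Finset.range n, J.jostTerm z k) atTop (𝓝 (J.jost z)) :=
  tendsto_const_nhds.add (Summable.of_norm_bounded (hs.mul_right (Real.exp J.Delta₁))
    (J.norm_jostTerm_le_closed hs hz)).hasSum.tendsto_sum_nat

theorem log_le_of_tendsto {u : ℕ → ℂ} {L : ℂ} {C : ℝ} (hC : 0 ≤ C) (hu : Tendsto u atTop (𝓝 L))
    (h : ∀ n, ‖u n‖ ≤ Real.exp C) : Real.log ‖L‖ ≤ C := by
  have hL : ‖L‖ ≤ Real.exp C := le_of_tendsto' hu.norm h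
  rcases (norm_nonneg L).eq_or_lt with h0 | h0
  -- `Real.log 0` is 0 rather than -∞, so the case of a vanishing limit needs `0 ≤ C`.
  · rw [← h0, Real.log_zero]
    exact hC
  · exact (Real.log_le_iff_le_exp h0).2 hL

end JacobiMatrix

/-! ### Trace class operators have absolutely summable diagonals -/

/-- Approximate factorization of `A` into two Hilbert-Schmidt factors dominated by `|A|^{1/2}`. -/
theorem exists_approx_factorization {H : Type*} [NormedAddCommGroup H]
    [InnerProductSpace ℂ H] [CompleteSpace H] (A : H →L[ℂ] H) {ε : ℝ} (hε : 0 < ε) :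
    ∃ B S : H →L[ℂ] H, star B * B ≤ absOp A ∧ star S * S ≤ absOp A ∧
      ‖A - B * S‖ ≤ ε := by
  set T := absOp A with hT
  have hT0 : 0 ≤ T := CFC.abs_nonneg A
  have hTT : T * T = star A * A := CFC.abs_mul_abs A
  have hsa : IsSelfAdjoint T := IsSelfAdjoint.of_nonneg hT0
  have hsp : ∀ t ∈ spectrum ℝ T, 0 ≤ t := fun t ht => spectrum_nonneg_of_nonneg hT0 ht
  -- A regularized t^(-1/2), replacing the partial isometry of the polar decomposition: with T =
  -- |A|, A r(T) plays the role of U T^(1/2). The defect is 1 - r(t)√t = ε/(t + ε), the function `q`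
  -- below.
  let r : ℝ → ℝ := fun t => √t / (t + ε)
  have hr : ContinuousOn r (spectrum ℝ T) := by
    refine Real.continuous_sqrt.continuousOn.div (by fun_prop) fun t ht => ?_
    have := hsp t ht
    positivity
  have hsq : ContinuousOn Real.sqrt (spectrum ℝ T) := Real.continuous_sqrt.continuousOn
  let q : ℝ → ℝ := fun t => ε / (t + ε)
  have hq : ContinuousOn q (spectrum ℝ T) := by
    refine continuousOn_const.div (by fun_prop) fun t ht => ?_
    have := hsp t ht
    positivity
  have hRsa : star (cfc r T) = cfc r T := (cfc_predicate r T).star_eq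
  have hSsa : star (cfc Real.sqrt T) = cfc Real.sqrt T := (cfc_predicate Real.sqrt T).star_eq
  have hQsa : star (cfc q T) = cfc q T := (cfc_predicate q T).star_eq
  have hid : cfc (fun t : ℝ => t) T = T := cfc_id' ℝ T
  have hsand : ∀ f : ℝ → ℝ, ContinuousOn f (spectrum ℝ T) →
      cfc f T * (T * T) * cfc f T = cfc (fun t => f t * (t * t) * f t) T := by
    intro f hf
    have hi : ContinuousOn (fun t : ℝ => t) (spectrum ℝ T) := continuousOn_id
    rw [cfc_mul (fun t => f t * (t * t)) f T (hf.mul (hi.mul hi)) hf,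
      cfc_mul f (fun t => t * t) T hf (hi.mul hi), cfc_mul (fun t => t) (fun t => t) T hi hi, hid]
  refine ⟨A * cfc r T, cfc Real.sqrt T, ?_, ?_, ?_⟩
  · have h1 : star (A * cfc r T) * (A * cfc r T) = cfc r T * (T * T) * cfc r T := by
      rw [star_mul, hRsa, hTT]
      simp only [mul_assoc]
    rw [h1, hsand r hr]
    conv_rhs => rw [← hid]
    refine cfc_mono (fun t ht => ?_) (by fun_prop) (by fun_prop)
    have h0 := hsp t ht
    have h2 : r t * (t * t) * r t = t * (t / (t + ε)) ^ 2 := by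
      simp only [r]
      rw [show √t / (t + ε) * (t * t) * (√t / (t + ε)) = (√t * √t) * (t / (t + ε)) ^ 2 by ring,
        Real.mul_self_sqrt h0]
    rw [h2]
    refine mul_le_of_le_one_right h0 (pow_le_one₀ (by positivity) ?_)
    exact div_le_one_of_le₀ (by linarith) (by positivity)
  · rw [hSsa, ← cfc_mul Real.sqrt Real.sqrt T hsq hsq]
    refine le_of_eq ((cfc_congr fun t ht => ?_).trans hid)
    exact Real.mul_self_sqrt (hsp t ht)
  · have h1 : A - A * cfc r T * cfc Real.sqrt T = A * cfc q T := by
      have h2 : cfc q T = 1 - cfc r T * cfc Real.sqrt T := by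
        rw [← cfc_mul r Real.sqrt T hr hsq, ← cfc_one ℝ T, ← cfc_sub 1 (fun t => r t * √t) T
          continuousOn_const (hr.mul hsq)]
        refine cfc_congr fun t ht => ?_
        have h0 := hsp t ht
        have h3 : t + ε ≠ 0 := by positivity
        simp only [q, r, Pi.one_apply]
        rw [div_mul_eq_mul_div, Real.mul_self_sqrt h0]
        field_simp
        ring
      rw [h2, mul_sub, mul_one, mul_assoc]
    rw [h1]
    -- The C*-identity and A*A = T² reduce this to the scalar bound εt/(t + ε) ≤ ε on the spectrum.
    have h4 : ‖A * cfc q T‖ * ‖A * cfc q T‖ ≤ ε * ε := by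
      rw [← CStarRing.norm_star_mul_self, star_mul, hQsa]
      rw [show cfc q T * star A * (A * cfc q T) = cfc q T * (T * T) * cfc q T by
        rw [hTT]; simp only [mul_assoc], hsand q hq]
      refine norm_cfc_le (by positivity) fun t ht => ?_
      have h0 := hsp t ht
      have h5 : q t * (t * t) * q t = (ε * (t / (t + ε))) * (ε * (t / (t + ε))) := by
        simp only [q]; ring
      have h6 : t / (t + ε) ≤ 1 := div_le_one_of_le₀ (by linarith) (by positivity)
      rw [h5, Real.norm_of_nonneg (by positivity)]
      have h7 : ε * (t / (t + ε)) ≤ ε := mul_le_of_le_one_right hε.le h6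
      exact mul_le_mul h7 h7 (by positivity) hε.le
    exact abs_le_of_sq_le_sq' (by simpa only [sq] using h4) hε.le |>.2

namespace HalfLine

theorem inner_e (x : HalfLine) (i : ℕ) : inner ℂ (e i) x = x i := by
  simp [e, lp.inner_single_left]

theorem entry_eq (A : HalfLine →L[ℂ] HalfLine) (i j : ℕ) : entry A i j = A (e j) i := inner_e _ _

theorem e_apply (i j : ℕ) : e j i = if i = j then 1 else 0 := by
  simp [e, Pi.single_apply]

theorem norm_e (i : ℕ) : ‖e i‖ = 1 := by
  simp [e, lp.norm_single]

theorem hasSum_norm_sq (x : HalfLine) : HasSum (fun n => ‖x n‖ ^ 2) (‖x‖ ^ 2) := by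
  have := lp.hasSum_norm (p := 2) (by norm_num) x
  simpa using this

/-- The Hilbert-Schmidt norm of the adjoint does not exceed that of the operator. -/
theorem sum_norm_adjoint_sq_le (B : HalfLine →L[ℂ] HalfLine) {w : ℕ → ℝ} (hw : Summable w)
    (h : ∀ m, ‖B (e m)‖ ^ 2 ≤ w m) (F : Finset ℕ) :
    ∑ i ∈ F, ‖ContinuousLinearMap.adjoint B (e i)‖ ^ 2 ≤ ∑' m, w m := by
  have hc : ∀ i m, ‖ContinuousLinearMap.adjoint B (e i) m‖ = ‖B (e m) i‖ := by
    intro i m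
    rw [← inner_e, ContinuousLinearMap.adjoint_inner_right, ← inner_e, norm_inner_symm]
  have hs : HasSum (fun m => ∑ i ∈ F, ‖B (e m) i‖ ^ 2)
      (∑ i ∈ F, ‖ContinuousLinearMap.adjoint B (e i)‖ ^ 2) := by
    refine hasSum_sum fun i _ => ?_
    simpa only [hc] using hasSum_norm_sq (ContinuousLinearMap.adjoint B (e i))
  refine hasSum_le (fun m => ?_) hs hw.hasSum
  exact (sum_le_hasSum F (fun _ _ => by positivity) (hasSum_norm_sq (B (e m)))).trans (h m)

theorem norm_sq_le_of_star_mul_le {B T : HalfLine →L[ℂ] HalfLine} (h : star B * B ≤ T)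
    (x : HalfLine) : ‖B x‖ ^ 2 ≤ (inner ℂ x (T x)).re := by
  have h1 := ((ContinuousLinearMap.le_def _ _).1 h).re_inner_nonneg_right x
  have h2 : inner ℂ x ((star B * B) x) = (‖B x‖ ^ 2 : ℂ) := by
    rw [ContinuousLinearMap.star_eq_adjoint, mul_apply_eq_comp,
      ContinuousLinearMap.adjoint_inner_right, inner_self_eq_norm_sq_to_K]
    rfl
  rw [sub_apply, inner_sub_right, h2] at h1
  simp only [map_sub, RCLike.re_to_complex] at h1
  norm_cast at h1
  linarith

/-- The entries of a trace class operator along two injective sequences of indices are absolutely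
summable. -/
theorem IsTraceClass.summable_norm_entry {A : HalfLine →L[ℂ] HalfLine} (hA : IsTraceClass A)
    {σ τ : ℕ → ℕ} (hσ : σ.Injective) (hτ : τ.Injective) :
    Summable fun n => ‖entry A (σ n) (τ n)‖ := by
  set w : ℕ → ℝ := fun n => (inner ℂ (e n) (absOp A (e n))).re with hw
  have hws : Summable w := Complex.reCLM.summable hA
  refine summable_of_sum_le (c := ∑' n, w n) (fun _ => norm_nonneg _) fun F => ?_
  refine le_of_forall_pos_le_add fun η hη => ?_
  -- The factorization error is paid once for each index of `F`, so the total stays below `η`.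
  have hε : 0 < η / (F.card + 1) := by positivity
  obtain ⟨B, S, hB, hS, hBS⟩ := exists_approx_factorization A hε
  have hB' := fun m => norm_sq_le_of_star_mul_le hB (e m)
  have hS' := fun m => norm_sq_le_of_star_mul_le hS (e m)
  have hw0 : ∀ m, 0 ≤ w m := fun m => (sq_nonneg _).trans (hB' m)
  have h1 := sum_norm_adjoint_sq_le B hws hB' (F.image σ)
  rw [Finset.sum_image hσ.injOn] at h1
  have h2 : ∑ n ∈ F, ‖S (e (τ n))‖ ^ 2 ≤ ∑' n, w n := by
    rw [← Finset.sum_image (f := fun m => ‖S (e m)‖ ^ 2) hτ.injOn]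
    exact (Finset.sum_le_sum fun m _ => hS' m).trans (hws.sum_le_tsum _ fun m _ => hw0 m)
  have h3 : ∀ n, ‖entry A (σ n) (τ n)‖ ≤
      (‖ContinuousLinearMap.adjoint B (e (σ n))‖ ^ 2 + ‖S (e (τ n))‖ ^ 2) / 2 +
        η / (F.card + 1) := by
    intro n
    have h4 : entry A (σ n) (τ n) =
        inner ℂ (ContinuousLinearMap.adjoint B (e (σ n))) (S (e (τ n))) +
          inner ℂ (e (σ n)) ((A - B * S) (e (τ n))) := by
      rw [ContinuousLinearMap.adjoint_inner_left, ← inner_add_right]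
      simp [entry]
    have h5 := norm_inner_le_norm (𝕜 := ℂ) (ContinuousLinearMap.adjoint B (e (σ n))) (S (e (τ n)))
    have h6 : ‖inner ℂ (e (σ n)) ((A - B * S) (e (τ n)))‖ ≤ η / (F.card + 1) := by
      refine (norm_inner_le_norm _ _).trans ?_
      rw [norm_e, one_mul]
      refine ((A - B * S).le_opNorm _).trans ?_
      rwa [norm_e, mul_one]
    rw [h4]
    refine (norm_add_le _ _).trans (add_le_add (h5.trans ?_) h6)
    nlinarith [sq_nonneg (‖ContinuousLinearMap.adjoint B (e (σ n))‖ - ‖S (e (τ n))‖)]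
  refine (Finset.sum_le_sum fun n _ => h3 n).trans ?_
  rw [Finset.sum_add_distrib, ← Finset.sum_div, Finset.sum_add_distrib, Finset.sum_const,
    nsmul_eq_mul]
  have h7 : (F.card : ℝ) * (η / (F.card + 1)) ≤ η := by
    rw [mul_div_assoc', div_le_iff₀ (by positivity)]
    nlinarith
  linarith

end HalfLine

namespace JacobiMatrix

open HalfLine

/-- The subdiagonal of `J - J₀`, shifted so that row `i` carries entry `i`. -/
def subdiagPert (J : JacobiMatrix) : ℕ → ℂ
  | 0 => 0
  | i + 1 => J.a i - 1

/-- At i = 0 the truncated index i - 1 reads x 0, but `subdiagPert` vanishes there. -/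
theorem op_sub_free_apply (J : JacobiMatrix) (x : HalfLine) (i : ℕ) :
    (J.op - free.op) x i =
      J.subdiagPert i * x (i - 1) + J.b i * x i + (J.c i - 1) * x (i + 1) := by
  rw [sub_apply, lp.coeFn_sub, Pi.sub_apply, op_apply, op_apply]
  cases i <;> simp [act, lower, free, subdiagPert] <;> ring

variable {J : JacobiMatrix} (hJ : IsTraceClass (J.op - free.op))
include hJ

theorem summable_norm_b : Summable fun n => ‖J.b n‖ := by
  refine (hJ.summable_norm_entry (σ := fun n => n) (τ := fun n => n) (fun _ _ h => h)
    fun _ _ h => h).congr fun n => ?_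
  rw [entry_eq, op_sub_free_apply]
  cases n <;> simp [e_apply, subdiagPert]

theorem summable_norm_a_sub : Summable fun n => ‖J.a n - 1‖ := by
  refine (hJ.summable_norm_entry (σ := fun n => n + 1) (τ := fun n => n)
    (fun _ _ h => Nat.succ_injective h) fun _ _ h => h).congr fun n => ?_
  rw [entry_eq, op_sub_free_apply]
  simp [e_apply, subdiagPert, show n + 1 + 1 ≠ n by omega]

theorem summable_norm_c_sub : Summable fun n => ‖J.c n - 1‖ := by
  refine (hJ.summable_norm_entry (σ := fun n => n) (τ := fun n => n + 1)
    (fun _ _ h => h) fun _ _ h => Nat.succ_injective h).congr fun n => ?_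
  rw [entry_eq, op_sub_free_apply]
  rcases n with _ | n
  · simp [e_apply, subdiagPert]
  · simp [e_apply, show n ≠ n + 1 + 1 by omega]

theorem summable_delta : Summable J.delta := by
  obtain ⟨M, hM⟩ := J.bounded
  have hb := (summable_nat_add_iff (f := fun n => ‖J.b n‖) 1).2 (summable_norm_b hJ)
  have hac : Summable fun n => ‖1 - J.a n * J.c n‖ := by
    refine Summable.of_nonneg_of_le (fun _ => norm_nonneg _) (fun n => ?_)
      ((summable_norm_a_sub hJ).add ((summable_norm_c_sub hJ).mul_left M))
    have h1 : 1 - J.a n * J.c n = -((J.a n - 1) + J.a n * (J.c n - 1)) := by ring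
    rw [h1, norm_neg]
    refine (norm_add_le _ _).trans ?_
    rw [norm_mul]
    gcongr
    exact (hM n).1
  exact (summable_nat_add_iff (f := J.delta) 1).1 (hb.add hac)

end JacobiMatrix

/-! ### The shift and the free resolvent -/

namespace HalfLine

/-- The right shift on sequences. -/
def shiftSeq (x : ℕ → ℂ) : ℕ → ℂ
  | 0 => 0
  | n + 1 => x n

theorem hasSum_norm_shiftSeq_sq (x : HalfLine) :
    HasSum (fun n => ‖shiftSeq x n‖ ^ 2) (‖x‖ ^ 2) := by
  rw [← hasSum_nat_add_iff' 1]
  simpa [shiftSeq] using hasSum_norm_sq x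

theorem memℓp_shiftSeq (x : HalfLine) : Memℓp (shiftSeq x) 2 :=
  memℓp_gen (by simpa using (hasSum_norm_shiftSeq_sq x).summable)

/-- The right shift as a linear map. -/
def shiftLinear : HalfLine →ₗ[ℂ] HalfLine where
  toFun x := ⟨shiftSeq x, memℓp_shiftSeq x⟩
  map_add' x y := by
    apply lp.ext
    funext n
    change shiftSeq (fun k => x k + y k) n = shiftSeq x n + shiftSeq y n
    cases n <;> simp [shiftSeq]
  map_smul' r x := by
    apply lp.ext
    funext n
    change shiftSeq (fun k => r * x k) n = r * shiftSeq x n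
    cases n <;> simp [shiftSeq]

theorem shiftLinear_apply (x : HalfLine) (n : ℕ) : shiftLinear x n = shiftSeq x n := rfl

theorem norm_shiftLinear (x : HalfLine) : ‖shiftLinear x‖ = ‖x‖ := by
  have h := hasSum_norm_sq (shiftLinear x)
  simp only [shiftLinear_apply] at h
  exact (sq_eq_sq₀ (norm_nonneg _) (norm_nonneg _)).1 (h.unique (hasSum_norm_shiftSeq_sq x))

/-- The right shift as a bounded operator. -/
noncomputable def shiftOp : HalfLine →L[ℂ] HalfLine :=
  shiftLinear.mkContinuous 1 fun x => by rw [norm_shiftLinear, one_mul]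

theorem shiftOp_apply (x : HalfLine) (n : ℕ) : shiftOp x n = shiftSeq x n := rfl

theorem shiftOp_e (n : ℕ) : shiftOp (e n) = e (n + 1) := by
  apply lp.ext
  funext k
  rw [shiftOp_apply]
  cases k <;> simp [shiftSeq, e_apply]

theorem norm_shiftOp_le : ‖shiftOp‖ ≤ 1 :=
  shiftLinear.mkContinuous_norm_le zero_le_one _

theorem star_shiftOp_apply (x : HalfLine) (n : ℕ) : star shiftOp x n = x (n + 1) := by
  rw [ContinuousLinearMap.star_eq_adjoint, ← inner_e, ContinuousLinearMap.adjoint_inner_right,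
    shiftOp_e, inner_e]

theorem star_shiftOp_mul_self : star shiftOp * shiftOp = 1 := by
  ext x n
  rw [mul_apply_eq_comp, star_shiftOp_apply, shiftOp_apply]
  rfl

end HalfLine

namespace JacobiMatrix

open HalfLine

theorem free_op_eq : free.op = shiftOp + star shiftOp := by
  ext x n
  rw [add_apply, lp.coeFn_add, Pi.add_apply, star_shiftOp_apply, shiftOp_apply, op_apply]
  cases n <;> simp [act, lower, free, shiftSeq]

/-- With S the right shift, S*S = 1 gives J₀ - λ(z) = -(1/z)(1 - zS*)(1 - zS), in this order. Both
factors are inverted by Neumann series. -/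
theorem isUnit_free_sub {z : ℂ} (h0 : z ≠ 0) (hz : ‖z‖ < 1) :
    IsUnit (free.op - (z + 1 / z) • ContinuousLinearMap.id ℂ HalfLine) := by
  have hu : ∀ A : HalfLine →L[ℂ] HalfLine, ‖A‖ ≤ 1 → IsUnit (1 - z • A) := fun A hA =>
    isUnit_one_sub_of_norm_lt_one <| by
      rw [norm_smul]
      exact (mul_le_of_le_one_right (norm_nonneg _) hA).trans_lt hz
  have h1 := (hu (star shiftOp) ((norm_star shiftOp).trans_le norm_shiftOp_le)).mul
    (hu shiftOp norm_shiftOp_le)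
  have h2 : free.op - (z + 1 / z) • ContinuousLinearMap.id ℂ HalfLine =
      (Units.mk0 (-(1 / z)) (by simpa using h0)) •
        ((1 - z • star shiftOp) * (1 - z • shiftOp)) := by
    have h3 : (1 - z • star shiftOp) * (1 - z • shiftOp) =
        1 - z • shiftOp - z • star shiftOp + (z * z) • (1 : HalfLine →L[ℂ] HalfLine) := by
      rw [sub_mul, one_mul, mul_sub, mul_one, smul_mul_smul_comm, star_shiftOp_mul_self]
      abel
    rw [h3, free_op_eq, Units.smul_def, Units.val_mk0, ← ContinuousLinearMap.one_def]
    match_scalars <;> field_simp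
    ring
  rw [h2]
  exact h1.smul _

/-- The lower triangular matrix `z^(k-m)`. -/
def powLower (z : ℂ) (k m : ℕ) : ℂ := if m ≤ k then z ^ (k - m) else 0

/-- The kernel `∑_{m ≤ min k j} z^(k+j-2m)`, which is `-1/z` times the free resolvent. -/
def green (z : ℂ) (k j : ℕ) : ℂ :=
  ∑ m ∈ Finset.range (k + 1), powLower z k m * powLower z j m

theorem green_succ (z : ℂ) (k j : ℕ) :
    green z (k + 1) j = z * green z k j + powLower z j (k + 1) := by
  rw [green, Finset.sum_range_succ, green, Finset.mul_sum]
  congr 1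
  · refine Finset.sum_congr rfl fun m hm => ?_
    have h : m ≤ k := Nat.lt_succ_iff.1 (Finset.mem_range.1 hm)
    simp only [powLower, if_pos h, if_pos (h.trans k.le_succ), Nat.succ_sub h, pow_succ]
    ring
  · simp [powLower]

theorem powLower_sub (z : ℂ) (j i : ℕ) :
    powLower z j i - z * powLower z j (i + 1) = if i = j then 1 else 0 := by
  unfold powLower
  rcases lt_trichotomy i j with h | h | h
  · rw [if_pos h.le, if_pos (show i + 1 ≤ j from h), if_neg h.ne, show j - i = j - (i + 1) + 1 by omega, pow_succ]
    ring
  · subst h; simp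
  · rw [if_neg (by omega), if_neg (by omega), if_neg (by omega)]
    ring

theorem green_zero (z : ℂ) (j : ℕ) : green z 0 j = powLower z j 0 := by
  simp [green, powLower]

/-- Up to the factor -z, this says that column j of the kernel solves (J₀ - λ)u = e_j. It combines
the one-step relations of the two triangular factors. -/
theorem green_equation (z : ℂ) (i j : ℕ) :
    (1 + z ^ 2) * green z i j - z * (if i = 0 then 0 else green z (i - 1) j) -
      z * green z (i + 1) j = if i = j then 1 else 0 := by
  rw [← powLower_sub z, green_succ]
  cases i with
  | zero => rw [green_zero]; simp; ring
  | succ i =>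
    simp only [Nat.add_sub_cancel, if_neg i.succ_ne_zero]
    linear_combination green_succ z i j

theorem sum_norm_powLower_le {z : ℂ} (hz : ‖z‖ < 1) (m : ℕ) (S : Finset ℕ) :
    ∑ j ∈ S, ‖powLower z j m‖ ≤ (1 - ‖z‖)⁻¹ := by
  have h : HasSum (fun j => ‖powLower z j m‖) (1 - ‖z‖)⁻¹ := by
    rw [← hasSum_nat_add_iff' m, Finset.sum_eq_zero, sub_zero]
    · simpa [powLower] using hasSum_geometric_of_lt_one (norm_nonneg z) hz
    · intro i hi
      simp [powLower, (Finset.mem_range.1 hi)]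
  exact sum_le_hasSum S (fun _ _ => norm_nonneg _) h

theorem sum_norm_powLower_le' {z : ℂ} (hz : ‖z‖ < 1) (k : ℕ) :
    ∑ m ∈ Finset.range (k + 1), ‖powLower z k m‖ ≤ (1 - ‖z‖)⁻¹ := by
  rw [← Finset.sum_range_reflect]
  refine le_trans (le_of_eq (Finset.sum_congr rfl fun m hm => ?_))
    (sum_le_hasSum (Finset.range (k + 1)) (fun _ _ => pow_nonneg (norm_nonneg z) _)
      (hasSum_geometric_of_lt_one (norm_nonneg z) hz))
  have := Finset.mem_range.1 hm
  rw [powLower, if_pos (by omega), norm_pow]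
  congr 1
  omega

theorem sum_norm_green_le {z : ℂ} (hz : ‖z‖ < 1) (k : ℕ) (S : Finset ℕ) :
    ∑ j ∈ S, ‖green z k j‖ ≤ (1 - ‖z‖)⁻¹ * (1 - ‖z‖)⁻¹ := by
  have h0 : 0 ≤ (1 - ‖z‖)⁻¹ := inv_nonneg.2 (by linarith)
  calc ∑ j ∈ S, ‖green z k j‖
      ≤ ∑ j ∈ S, ∑ m ∈ Finset.range (k + 1), ‖powLower z k m‖ * ‖powLower z j m‖ := by
        refine Finset.sum_le_sum fun j _ => (norm_sum_le _ _).trans (le_of_eq ?_)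
        simp only [norm_mul]
    _ = ∑ m ∈ Finset.range (k + 1), ‖powLower z k m‖ * ∑ j ∈ S, ‖powLower z j m‖ := by
        rw [Finset.sum_comm]
        simp only [Finset.mul_sum]
    _ ≤ ∑ m ∈ Finset.range (k + 1), ‖powLower z k m‖ * (1 - ‖z‖)⁻¹ := by
        gcongr
        exact sum_norm_powLower_le hz _ _
    _ ≤ _ := by
        rw [← Finset.sum_mul]
        gcongr
        exact sum_norm_powLower_le' hz k

theorem green_comm (z : ℂ) (k j : ℕ) : green z k j = green z j k := by
  have h : ∀ k j, green z k j = ∑ m ∈ Finset.range (max k j + 1), powLower z k m * powLower z j m := by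
    intro k j
    refine Finset.sum_subset (fun m hm => ?_) fun m _ hm => ?_
    · simp only [Finset.mem_range] at hm ⊢
      omega
    · simp only [Finset.mem_range, not_lt] at hm
      rw [powLower, if_neg (by omega), zero_mul]
  rw [h, h, max_comm]
  simp only [mul_comm]

theorem memℓp_green {z : ℂ} (hz : ‖z‖ < 1) (j : ℕ) :
    Memℓp (fun k => -z * green z k j) 2 := by
  have h1 : Memℓp (fun k => -z * green z k j) 1 := by
    refine memℓp_gen ?_
    have h2 : Summable fun k => ‖green z k j‖ :=
      summable_of_sum_le (fun _ => norm_nonneg _) fun F => by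
        simpa only [green_comm z _ j] using sum_norm_green_le hz j F
    simpa using h2.mul_left ‖z‖
  exact h1.of_exponent_ge (by norm_num)

/-- The entries of the free resolvent. -/
theorem freeResolvent_zhukovsky_apply {z : ℂ} (hz : ‖z‖ < 1) (j k : ℕ) :
    freeResolvent (zhukovsky z) (e j) k = -z * green z k j := by
  by_cases h0 : z = 0
  · have : freeResolvent (zhukovsky z) = 0 := by
      rw [zhukovsky, if_pos h0]
      rfl
    rw [this, h0]
    simp
  · let g : HalfLine := ⟨fun k => -z * green z k j, memℓp_green hz j⟩
    have hg : ∀ k, g k = -z * green z k j := fun _ => rfl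
    have hR : freeResolvent (zhukovsky z) =
        Ring.inverse (free.op - (z + 1 / z) • ContinuousLinearMap.id ℂ HalfLine) := by
      rw [zhukovsky, if_neg h0]
      rfl
    have hT : (free.op - (z + 1 / z) • ContinuousLinearMap.id ℂ HalfLine) g = e j := by
      apply lp.ext
      funext i
      rw [sub_apply, lp.coeFn_sub, Pi.sub_apply, op_apply, e_apply, ← green_equation z i j]
      have h1 : ((z + 1 / z) • ContinuousLinearMap.id ℂ HalfLine) g i = (z + 1 / z) * g i := rfl
      rw [h1]
      cases i <;> simp only [act, lower, free, hg, if_true, Nat.succ_ne_zero, if_false,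
        Nat.add_sub_cancel] <;> field_simp <;> ring
    rw [hR, ← hT, ← mul_apply_eq_comp, Ring.inverse_mul_cancel _ (isUnit_free_sub h0 hz)]
    rfl

/-! ### Sections of the perturbation kernel and the limit -/

/-- The kernel of `(J - J₀)(J₀ - λ(z))⁻¹`. -/
def pertKernel (J : JacobiMatrix) (z : ℂ) (i j : ℕ) : ℂ :=
  -z * (J.subdiagPert i * green z (i - 1) j + J.b i * green z i j +
    (J.c i - 1) * green z (i + 1) j)

theorem entry_pert (J : JacobiMatrix) {z : ℂ} (hz : ‖z‖ < 1) (i j : ℕ) :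
    entry ((J.op - free.op) * freeResolvent (zhukovsky z)) i j = J.pertKernel z i j := by
  rw [entry_eq, mul_apply_eq_comp, op_sub_free_apply]
  simp only [freeResolvent_zhukovsky_apply hz, pertKernel]
  ring

theorem principalMinor_pert (J : JacobiMatrix) {z : ℂ} (hz : ‖z‖ < 1) :
    principalMinor ((J.op - free.op) * freeResolvent (zhukovsky z)) =
      fun S : Finset ℕ => Matrix.det (Matrix.of fun i j : S => J.pertKernel z i j) := by
  funext S
  simp only [principalMinor, J.entry_pert hz]

theorem sum_norm_pertKernel_le (J : JacobiMatrix) {z : ℂ} (hz : ‖z‖ < 1) (i : ℕ) (S : Finset ℕ) :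
    ∑ j ∈ S, ‖J.pertKernel z i j‖ ≤
      (‖J.subdiagPert i‖ + ‖J.b i‖ + ‖J.c i - 1‖) * ((1 - ‖z‖)⁻¹ * (1 - ‖z‖)⁻¹) := by
  calc ∑ j ∈ S, ‖J.pertKernel z i j‖
      ≤ ∑ j ∈ S, (‖J.subdiagPert i‖ * ‖green z (i - 1) j‖ + ‖J.b i‖ * ‖green z i j‖ +
          ‖J.c i - 1‖ * ‖green z (i + 1) j‖) := by
        refine Finset.sum_le_sum fun j _ => ?_
        rw [pertKernel, norm_mul, norm_neg]
        refine (mul_le_of_le_one_left (norm_nonneg _) hz.le).trans ((norm_add₃_le).trans ?_)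
        simp only [norm_mul, le_refl]
    _ = ‖J.subdiagPert i‖ * ∑ j ∈ S, ‖green z (i - 1) j‖ + ‖J.b i‖ * ∑ j ∈ S, ‖green z i j‖ +
          ‖J.c i - 1‖ * ∑ j ∈ S, ‖green z (i + 1) j‖ := by
        simp only [Finset.sum_add_distrib, Finset.mul_sum]
    _ ≤ _ := by
        rw [add_mul, add_mul]
        gcongr <;> exact sum_norm_green_le hz _ _

theorem summable_principalMinor_pert {J : JacobiMatrix} (hJ : IsTraceClass (J.op - free.op)) {z : ℂ}
    (hz : ‖z‖ < 1) :
    Summable (principalMinor ((J.op - free.op) * freeResolvent (zhukovsky z))) := by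
  rw [J.principalMinor_pert hz]
  have hl : Summable fun i => ‖J.subdiagPert i‖ :=
    (summable_nat_add_iff (f := fun i => ‖J.subdiagPert i‖) 1).1 (summable_norm_a_sub hJ)
  exact summable_det_of_row_bound _ _
    (((hl.add (summable_norm_b hJ)).add (summable_norm_c_sub hJ)).mul_right _)
    (J.sum_norm_pertKernel_le hz)

/-- The tridiagonal matrix with diagonal `d`, subdiagonal `a` and superdiagonal `c`. -/
def tridiag (d a c : ℕ → ℂ) (i k : ℕ) : ℂ :=
  (if i = k + 1 then a k else 0) + (if i = k then d i else 0) + if i + 1 = k then c i else 0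

theorem tridiag_eq_zero (d a c : ℕ → ℂ) {i j : ℕ} (h : i + 1 < j ∨ j + 1 < i) :
    tridiag d a c i j = 0 := by
  rw [tridiag, if_neg (by omega), if_neg (by omega), if_neg (by omega)]
  simp

theorem det_leading_tridiag (d a c : ℕ → ℂ) (n : ℕ) :
    (Matrix.leading (tridiag d a c) (n + 2)).det =
      d (n + 1) * (Matrix.leading (tridiag d a c) (n + 1)).det -
        a n * c n * (Matrix.leading (tridiag d a c) n).det := by
  rw [Matrix.det_leading_tridiagonal _ fun i j h => tridiag_eq_zero d a c h]
  have h1 : tridiag d a c (n + 1) (n + 1) = d (n + 1) := by simp [tridiag]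
  have h2 : tridiag d a c (n + 1) n = a n := by simp [tridiag, show n + 1 + 1 ≠ n by omega]
  have h3 : tridiag d a c n (n + 1) = c n := by simp [tridiag, show n ≠ n + 1 + 1 by omega]
  rw [h1, h2, h3]

theorem det_leading_tridiag_zero (d a c : ℕ → ℂ) :
    (Matrix.leading (tridiag d a c) 0).det = 1 := Matrix.det_fin_zero

theorem det_leading_tridiag_one (d a c : ℕ → ℂ) :
    (Matrix.leading (tridiag d a c) 1).det = d 0 := by
  simp [Matrix.leading, tridiag]

theorem det_leading_eq_truncDet (J : JacobiMatrix) (z : ℂ) (n : ℕ) :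
    (Matrix.leading (tridiag (fun i => 1 + z ^ 2 - z * J.b i) (fun i => -z * J.a i)
      (fun i => -z * J.c i)) n).det = J.truncDet z n := by
  induction n using Nat.twoStepInduction with
  | zero => exact det_leading_tridiag_zero _ _ _
  | one => exact det_leading_tridiag_one _ _ _
  | more n h0 h1 => rw [det_leading_tridiag, h0, h1, truncDet]; ring

/-- The determinant is affine in the last diagonal entry, with slope D_n. The correction -z² c_n is
what truncating the product with the Green kernel leaves in that entry. -/
theorem det_leading_update (J : JacobiMatrix) (z : ℂ) (n : ℕ) :
    (Matrix.leading (tridiag (Function.update (fun i => 1 + z ^ 2 - z * J.b i) n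
      (1 + z ^ 2 - z * J.b n - z ^ 2 * J.c n)) (fun i => -z * J.a i)
      (fun i => -z * J.c i)) (n + 1)).det =
      J.truncDet z (n + 1) - z ^ 2 * J.c n * J.truncDet z n := by
  cases n with
  | zero => rw [det_leading_tridiag_one]; simp [truncDet]
  | succ n =>
    have h : ∀ m ≤ n + 1, (Matrix.leading (tridiag (Function.update (fun i => 1 + z ^ 2 - z * J.b i)
        (n + 1) (1 + z ^ 2 - z * J.b (n + 1) - z ^ 2 * J.c (n + 1))) (fun i => -z * J.a i)
        (fun i => -z * J.c i)) m).det = J.truncDet z m := by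
      intro m hm
      rw [← det_leading_eq_truncDet]
      refine Matrix.det_leading_congr fun i hi j _ => ?_
      simp only [tridiag, Function.update_of_ne (show i ≠ n + 1 by omega)]
    rw [det_leading_tridiag, h _ le_rfl, h _ n.le_succ, Function.update_self, truncDet]
    ring

theorem det_leading_green (z : ℂ) (n : ℕ) : (Matrix.leading (green z) n).det = 1 := by
  have h : Matrix.leading (green z) n =
      Matrix.leading (powLower z) n * (Matrix.leading (powLower z) n).transpose := by
    ext i j
    simp only [Matrix.mul_apply, Matrix.transpose_apply, Matrix.leading, Matrix.of_apply]
    rw [Fin.sum_univ_eq_sum_range (fun m => powLower z i m * powLower z j m) n]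
    refine Finset.sum_subset (fun m hm => ?_) fun m _ hm => ?_
    · simp only [Finset.mem_range] at hm ⊢
      omega
    · simp only [Finset.mem_range, not_lt] at hm
      rw [powLower, if_neg (by omega), zero_mul]
  have hL : (Matrix.leading (powLower z) n).det = 1 := by
    rw [Matrix.det_of_isLowerTriangular]
    · simp [Matrix.leading, powLower]
    · intro i j hij
      have : (i : ℕ) < j := hij
      simp only [Matrix.leading, Matrix.of_apply, powLower, if_neg this.not_ge]
  rw [h, Matrix.det_mul, Matrix.det_transpose, hL, one_mul]

theorem sum_tridiag_mul (d a c u : ℕ → ℂ) {n i : ℕ} (hi : i < n + 1) :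
    ∑ k ∈ Finset.range (n + 1), tridiag d a c i k * u k =
      (if i = 0 then 0 else a (i - 1) * u (i - 1)) + d i * u i +
        if i = n then 0 else c i * u (i + 1) := by
  simp only [tridiag, add_mul, ite_mul, zero_mul, Finset.sum_add_distrib, Finset.sum_ite_eq,
    Finset.mem_range, if_pos hi]
  congr 1
  · congr 1
    cases i with
    | zero => simp
    | succ i => simp [show i < n + 1 by omega]
  · by_cases h : i = n
    · simp [h]
    · simp [h, show i < n by omega]

/-- The sections of the perturbation kernel are expressed by the truncated determinants. -/
theorem det_one_add_leading_pertKernel (J : JacobiMatrix) (z : ℂ) (n : ℕ) :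
    (1 + Matrix.leading (J.pertKernel z) (n + 1)).det =
      J.truncDet z (n + 1) - z ^ 2 * J.c n * J.truncDet z n := by
  -- Since the Green section has determinant 1, it suffices to show that 1 + A restricted to the
  -- section is the corrected tridiagonal matrix times the Green section.
  have hmul : ∀ M : Matrix (Fin (n + 1)) (Fin (n + 1)) ℂ,
      (M * Matrix.leading (green z) (n + 1)).det = M.det := fun M => by
    rw [Matrix.det_mul, det_leading_green, mul_one]
  rw [← det_leading_update, ← hmul (Matrix.leading _ _)]
  congr 1
  ext i j
  obtain ⟨i, hi⟩ := i
  obtain ⟨j, hj⟩ := j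
  simp only [Matrix.add_apply, Matrix.one_apply, Matrix.mul_apply, Matrix.leading, Matrix.of_apply,
    Fin.mk.injEq]
  rw [Fin.sum_univ_eq_sum_range (fun k => tridiag _ _ _ i k * green z k j) (n + 1),
    sum_tridiag_mul _ _ _ _ hi, ← green_equation, pertKernel]
  have hlow : J.subdiagPert i * green z (i - 1) j =
      if i = 0 then 0 else (J.a (i - 1) - 1) * green z (i - 1) j := by
    cases i <;> simp [subdiagPert]
  rw [hlow]
  by_cases h : i = n
  · subst h
    -- In the last row the neighbour n + 1 lies outside the section. As j ≤ n, its Green entry is z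
    -- times the one at n, so -z c_n G(n+1, j) moves into the diagonal as -z² c_n G(n, j).
    have hg : green z (i + 1) j = z * green z i j := by
      rw [green_succ, powLower, if_neg (by omega), add_zero]
    rw [hg, Function.update_self, if_pos rfl]
    split_ifs <;> ring
  · rw [Function.update_of_ne h, if_neg h]
    split_ifs <;> ring

/-- The perturbation determinant is the limit of the partial sums of the Jost series. -/
theorem tendsto_perturbationDet {J : JacobiMatrix} (hJ : IsTraceClass (J.op - free.op)) {z : ℂ}
    (hz : ‖z‖ < 1) :
    Tendsto (fun n => 1 + ∑ k ∈ Finset.range (n + 1), J.jostTerm z k) atTop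
      (𝓝 (perturbationDet (zhukovsky z) J)) := by
  -- The powersets of the initial segments are cofinal among finite families of finite sets, so
  -- summing over them computes the unordered sum.
  have h1 := (summable_principalMinor_pert hJ hz).hasSum.comp
    (tendsto_finset_powerset_atTop_atTop.comp
      (tendsto_finset_range.comp (tendsto_add_atTop_nat 1)))
  have h2 : Tendsto (fun n => z ^ 2 * (J.c n - 1) * J.truncDet z n) atTop (𝓝 0) := by
    have h3 : Tendsto (fun n => ‖J.c n - 1‖ *
        (2 / ‖1 - z ^ 2‖ * Real.exp (2 * ‖z‖ * J.Delta / ‖1 - z ^ 2‖))) atTop (𝓝 0) := by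
      simpa using (summable_norm_c_sub hJ).tendsto_atTop_zero.mul_const _
    refine squeeze_zero_norm (fun n => ?_) h3
    rw [norm_mul, norm_mul, norm_pow]
    refine mul_le_mul (mul_le_of_le_one_left (norm_nonneg _)
      (pow_le_one₀ (norm_nonneg _) hz.le)) ?_ (norm_nonneg _) (norm_nonneg _)
    refine (J.norm_truncDet_le_div hz n).trans ?_
    gcongr
    exact J.jostMajorant_le_inside (summable_delta hJ) hz n
  have h4 := h1.add h2
  rw [add_zero] at h4
  refine h4.congr fun n => ?_
  simp only [Function.comp_apply]
  rw [J.principalMinor_pert hz, Matrix.sum_powerset_range_det, det_one_add_leading_pertKernel,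
    ← truncDet_succ_sub]
  ring

end JacobiMatrix

theorem mainTheorem4 (J : JacobiMatrix)
    (hJ : HalfLine.IsTraceClass (J.op - JacobiMatrix.free.op)) :
    (Summable J.delta ∧
      ∀ z ∈ Metric.ball (0 : ℂ) 1,
        Summable (HalfLine.principalMinor
          ((J.op - JacobiMatrix.free.op) * JacobiMatrix.freeResolvent (zhukovsky z))) ∧
        Real.log ‖JacobiMatrix.perturbationDet (zhukovsky z) J‖
          ≤ 2 * ‖z‖ * J.Delta / ‖1 - z ^ 2‖) ∧
    (Summable (fun n : ℕ => ((n : ℝ) + 1) * J.delta n) →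
      ∃ F : ℂ → ℂ, ContinuousOn F (Metric.closedBall 0 1) ∧
        (∀ z ∈ Metric.ball (0 : ℂ) 1,
          F z = JacobiMatrix.perturbationDet (zhukovsky z) J) ∧
        ∀ z ∈ Metric.closedBall (0 : ℂ) 1, Real.log ‖F z‖ ≤ ‖z‖ * J.Delta₁) := by
  have hd := JacobiMatrix.summable_delta hJ
  refine ⟨⟨hd, fun z hz => ?_⟩, fun hs => ⟨J.jost, J.continuousOn_jost hs, fun z hz => ?_,
    fun z hz => ?_⟩⟩
  · rw [mem_ball_zero_iff] at hz
    refine ⟨JacobiMatrix.summable_principalMinor_pert hJ hz, ?_⟩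
    have hD : 0 ≤ J.Delta := tsum_nonneg J.delta_nonneg
    exact JacobiMatrix.log_le_of_tendsto (by positivity) (JacobiMatrix.tendsto_perturbationDet hJ hz)
      fun n => (J.norm_one_add_sum_le z _).trans (J.jostMajorant_le_inside hd hz _)
  · rw [mem_ball_zero_iff] at hz
    -- The Jost series is the continuous extension: inside the disk its partial sums also converge
    -- to the determinant.
    exact tendsto_nhds_unique ((J.tendsto_jost hs hz.le).comp (tendsto_add_atTop_nat 1))
      (JacobiMatrix.tendsto_perturbationDet hJ hz)
  · rw [mem_closedBall_zero_iff] at hz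
    have hD : 0 ≤ J.Delta₁ :=
      tsum_nonneg fun k => mul_nonneg (by positivity) (J.delta_nonneg k)
    exact JacobiMatrix.log_le_of_tendsto (by positivity) (J.tendsto_jost hs hz)
      fun n => (J.norm_one_add_sum_le z n).trans (J.jostMajorant_le_closed hs hz n)
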